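/- We work over $\mathbb{C}$. Let $\mathcal{A}$ be a $\mathbb{C}$-linear triangulated category with an exact $\mathbb{C}$-linear equivalence $\mathcal{A} \simeq \mathrm{Perf}(\mathcal{C})$ with the derived category of perfect DG-modules over a smooth and proper DG-algebra $\mathcal{C}$, and put $\mathrm{HH}_\bullet(\mathcal{A}) := \mathrm{HH}_\bullet(\mathcal{C})$ (Hochschild homology). Assume that $\mathcal{A}$ is Calabi–Yau of dimension $3$, i.e. the shift $[3]$ is a Serre functor of $\mathcal{A}$. **Definitions.** For $F, G \in \mathcal{A}$ let $\mathrm{Hom}^k(F,G) = \mathrm{Hom}(F,G[k])$, $k \in \mathbb{Z}$; $\mathrm{Hom}^\bullet(F,F)$ is a graded algebra under composition. A *rank function* is a map $\mathrm{rk}$ from the objects of $\mathcal{A}$ to $\mathbb{Z}$ which is additive on distinguished triangles and satisfies $\mathrm{rk}(F[1]) = -\mathrm{rk}(F)$; it is *non-trivial* if it is not identically zero. Let $\mathrm{K}_{num}(\mathcal{A})$ be the quotient of $\mathrm{K}_0(\mathcal{A})$ by the kernel of the Euler pairing $\chi(E,F) = \sum_{k \in \mathbb{Z}} (-1)^k \dim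 \mathrm{Hom}^k(E,F)$; the rank function is *numerical* if it descends to $\mathrm{K}_{num}(\mathcal{A})$. A *homological unit* for $\mathcal{A}$ with respect to $\mathrm{rk}$ is a $\mathbb{Z}$-graded unital $\mathbb{C}$-algebra $T^\bullet$ which is maximal (every injective morphism of graded algebras from it to another graded algebra with the same property is an isomorphism) for the following property: for every $F \in \mathcal{A}$ there are a morphism of graded algebras $i_F : T^\bullet \to \mathrm{Hom}^\bullet(F,F)$ and a morphism of graded vector spaces $t_F : \mathrm{Hom}^\bullet(F,F) \to T^\bullet$ such that $\psi[k] \circ i_F(a) = i_G(a) \circ \psi$ for all $\psi : F \to G$ and $a \in T^k$, and $t_F(i_F(a)) = \mathrm{rk}(F)\, a$ for all $a \in T^\bullet$. An object $F$ is *unitary* with respect to $T^\bullet$ if $\mathrm{Hom}^\bullet(F,F) \simeq T^\bullet$ as graded rings. The *Hodge numbers* $h^{p,q}$ ($0 \le p,q \le 3$) associated to $T^\bullet$ are the rational numbers with $h^{p,q} = h^{q,p}$ and $$h^{i,0} = \dim T^{3-i} \ (0 \le i \le 3), \quad h^{3,1} = \dim \mathrm{HH}_{-2}(\mathcal{A})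 - h^{2,0}, \quad h^{3,2} = h^{1,0}, \quad h^{2,1} = \dim \mathrm{HH}_{-1}(\mathcal{A}) - h^{1,0} - h^{3,2},$$ $$h^{3,3} = h^{0,0}, \qquad h^{1,1} = h^{2,2} = \tfrac{1}{2}\left(\dim \mathrm{HH}_0(\mathcal{A}) - h^{0,0} - h^{3,3}\right).$$ **Theorem.** Let $\mathrm{rk}_1, \mathrm{rk}_2$ be non-trivial rank functions on $\mathcal{A}$, let $T_1^\bullet, T_2^\bullet$ be homological units for $\mathcal{A}$ with respect to $\mathrm{rk}_1$, $\mathrm{rk}_2$, let $\mathcal{A}^{(i)}_{unitary}$ be the set of objects that are unitary with respect to $T_i^\bullet$, and let $h_i^{p,q}$ be the Hodge numbers associated to $T_i^\bullet$. 1. (a) If the classes of the objects of $\mathcal{A}^{(1)}_{unitary}$ generate $\mathrm{K}_0(\mathcal{A}) \otimes \mathbb{C}$ and so do the classes of the objects of $\mathcal{A}^{(2)}_{unitary}$, then $h_1^{p,q} = h_2^{p,q}$ for all $p,q \in \{0,\dots,3\}$. (b) If $T_1^\bullet \simeq \mathbb{C} \oplus \mathbb{C}[3]$ as graded algebras (one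 copy of $\mathbb{C}$ in degree $0$, one in degree $3$), the classes of the objects of $\mathcal{A}^{(1)}_{unitary}$ generate $\mathrm{K}_0(\mathcal{A}) \otimes \mathbb{C}$, and there is an object that is unitary with respect to $T_2^\bullet$, then $h_1^{p,q} = h_2^{p,q}$ for all $p,q \in \{0,\dots,3\}$. 2. If $\mathrm{rk}_1$ and $\mathrm{rk}_2$ are numerical, then (a) and (b) also hold with $\mathrm{K}_0(\mathcal{A})$ replaced by $\mathrm{K}_{num}(\mathcal{A})$. -/

import Mathlib

open CategoryTheory CategoryTheory.Limits
open scoped TensorProduct DirectSum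

universe w v u t t₁ t₂

noncomputable section

namespace CYHodge

/-! ## Differential graded algebras over `ℂ` -/

/-- A differential graded `ℂ`-algebra: a `ℤ`-graded unital associative algebra with a
differential of degree `+1` satisfying the graded Leibniz rule. -/
structure DGAlgebra where
  carrier : Type w
  [ring : Ring carrier]
  [algebra : Algebra ℂ carrier]
  deg : ℤ → Submodule ℂ carrier
  [graded : GradedAlgebra deg]
  d : carrier →ₗ[ℂ] carrier
  d_mem : ∀ i a, a ∈ deg i → d a ∈ deg (i + 1)
  d_d : ∀ a, d (d a) = 0
  d_mul : ∀ i a, a ∈ deg i → ∀ b, d (a * b) = d a * b + i.negOnePow • (a * d b)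

instance : CoeSort DGAlgebra.{w} (Type w) := ⟨DGAlgebra.carrier⟩

attribute [instance] DGAlgebra.ring DGAlgebra.algebra DGAlgebra.graded

/-- The total cohomology of a square-zero endomorphism. -/
abbrev TotalCohomology {V : Type w} [AddCommGroup V] [Module ℂ V] (d : V →ₗ[ℂ] V) : Type w :=
  LinearMap.ker d ⧸ (LinearMap.range d).comap (LinearMap.ker d).subtype

/-- A DG-algebra is proper if its total cohomology is finite dimensional. -/
def DGAlgebra.IsProper (C : DGAlgebra.{w}) : Prop :=
  Module.Finite ℂ (TotalCohomology C.d)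

/-! ## Right DG-modules -/

/-- A right DG-module over `C` (a right `C`-module being a module over `Cᵐᵒᵖ`). -/
structure DGModule (C : DGAlgebra.{w}) where
  carrier : Type w
  [addCommGroup : AddCommGroup carrier]
  [module : Module ℂ carrier]
  [opModule : Module C.carrierᵐᵒᵖ carrier]
  [tower : IsScalarTower ℂ C.carrierᵐᵒᵖ carrier]
  deg : ℤ → Submodule ℂ carrier
  isInternal : DirectSum.IsInternal deg
  smul_mem : ∀ i j m c, m ∈ deg i → c ∈ C.deg j → MulOpposite.op c • m ∈ deg (i + j)
  d : carrier →ₗ[ℂ] carrier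
  d_mem : ∀ i m, m ∈ deg i → d m ∈ deg (i + 1)
  d_d : ∀ m, d (d m) = 0
  d_smul : ∀ i m, m ∈ deg i → ∀ c : C,
    d (MulOpposite.op c • m) = MulOpposite.op c • d m + i.negOnePow • MulOpposite.op (C.d c) • m

attribute [instance] DGModule.addCommGroup DGModule.module DGModule.opModule DGModule.tower

namespace DGModule

variable {C : DGAlgebra.{w}}

instance : CoeSort (DGModule C) (Type w) := ⟨DGModule.carrier⟩

instance (M : DGModule C) : SMulCommClass C.carrierᵐᵒᵖ ℂ M :=
  IsScalarTower.to_smulCommClass'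

/-- Closed morphisms of degree `0` between DG-modules. -/
def cocycles (M N : DGModule C) : Submodule ℂ (M →ₗ[C.carrierᵐᵒᵖ] N) where
  carrier := {f | (∀ i m, m ∈ M.deg i → f m ∈ N.deg i) ∧ ∀ m, f (M.d m) = N.d (f m)}
  add_mem' {f g} hf hg := by
    refine ⟨fun i m hm => ?_, fun m => ?_⟩
    · exact (N.deg i).add_mem (hf.1 i m hm) (hg.1 i m hm)
    · simp [hf.2 m, hg.2 m]
  zero_mem' := by
    refine ⟨fun i m hm => ?_, fun m => ?_⟩ <;> simp
  smul_mem' a f hf := by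
    refine ⟨fun i m hm => ?_, fun m => ?_⟩
    · exact (N.deg i).smul_mem a (hf.1 i m hm)
    · simp [hf.2 m]

/-- The category of right DG-modules and closed morphisms of degree `0`. -/
instance : Category (DGModule C) where
  Hom M N := cocycles M N
  id M := ⟨LinearMap.id, fun _ _ h => h, fun _ => rfl⟩
  comp f g := ⟨g.1.comp f.1, fun i m h => g.2.1 i _ (f.2.1 i m h), fun m => by
    simp [f.2.2 m, g.2.2]⟩

instance : Preadditive (DGModule C) where
  homGroup M N := inferInstanceAs (AddCommGroup (cocycles M N))
  add_comp M N P f f' g := by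
    apply Subtype.ext
    exact LinearMap.comp_add f.1 f'.1 g.1
  comp_add M N P f g g' := by
    apply Subtype.ext
    rfl

instance : Linear ℂ (DGModule C) where
  homModule M N := inferInstanceAs (Module ℂ (cocycles M N))
  smul_comp M N P a f g := by
    apply Subtype.ext
    apply LinearMap.ext
    intro m
    exact (g.1.restrictScalars ℂ).map_smul a (f.1 m)
  comp_smul M N P f a g := by
    apply Subtype.ext
    rfl

/-- Two closed morphisms are homotopic if their difference is `d h + h d` for a right
`C`-linear map `h` of degree `-1`. -/
def homotopic : HomRel (DGModule C) := fun M N f g =>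
  ∃ h : M →ₗ[C.carrierᵐᵒᵖ] N, (∀ i m, m ∈ M.deg i → h m ∈ N.deg (i - 1)) ∧
    ∀ m, f.1 m = g.1 m + (N.d (h m) + h (M.d m))

lemma homotopic_add ⦃M N : DGModule C⦄ (f₁ f₂ g₁ g₂ : M ⟶ N)
    (hf : homotopic f₁ f₂) (hg : homotopic g₁ g₂) : homotopic (f₁ + g₁) (f₂ + g₂) := by
  obtain ⟨h, hd, hh⟩ := hf
  obtain ⟨k, kd, kk⟩ := hg
  refine ⟨h + k, fun i m hm => (N.deg _).add_mem (hd i m hm) (kd i m hm), fun m => ?_⟩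
  change f₁.1 m + g₁.1 m = (f₂.1 m + g₂.1 m) + _
  rw [hh, kk]
  simp only [LinearMap.add_apply, map_add]
  abel

lemma homotopic_smul (a : ℂ) ⦃M N : DGModule C⦄ (f₁ f₂ : M ⟶ N)
    (hf : homotopic f₁ f₂) : homotopic (a • f₁) (a • f₂) := by
  obtain ⟨h, hd, hh⟩ := hf
  refine ⟨a • h, fun i m hm => (N.deg _).smul_mem a (hd i m hm), fun m => ?_⟩
  change a • f₁.1 m = a • f₂.1 m + _
  rw [hh]
  simp only [LinearMap.smul_apply, map_smul, smul_add]

instance : Congruence (homotopic (C := C)) where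
  equivalence {M N} :=
    { refl := fun f => ⟨0, fun i m _ => by simp, fun m => by simp⟩
      symm := by
        rintro f g ⟨h, hd, hh⟩
        refine ⟨-h, fun i m hm => (N.deg _).neg_mem (hd i m hm), fun m => ?_⟩
        rw [hh]
        simp only [LinearMap.neg_apply, map_neg]
        abel
      trans := by
        rintro f g k ⟨h, hd, hh⟩ ⟨h', hd', hh'⟩
        refine ⟨h + h', fun i m hm => (N.deg _).add_mem (hd i m hm) (hd' i m hm), fun m => ?_⟩
        rw [hh, hh']
        simp only [LinearMap.add_apply, map_add]
        abel }
  comp_left {M N P} f g g' := by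
    rintro ⟨h, hd, hh⟩
    refine ⟨h.comp f.1, fun i m hm => hd i _ (f.2.1 i m hm), fun m => ?_⟩
    change g.1 (f.1 m) = g'.1 (f.1 m) + _
    rw [hh]
    simp [f.2.2 m]
  comp_right {M N P} f f' g := by
    rintro ⟨h, hd, hh⟩
    refine ⟨g.1.comp h, fun i m hm => g.2.1 _ _ (hd i m hm), fun m => ?_⟩
    change g.1 (f.1 m) = g.1 (f'.1 m) + _
    rw [hh]
    simp [g.2.2]

/-- The shift `M[1]`, with `M[1]^i = M^{i+1}` and differential `-d`. -/
def shift (M : DGModule C) : DGModule C where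
  carrier := M.carrier
  deg i := M.deg (i + 1)
  isInternal := by
    apply DirectSum.isInternal_submodule_of_iSupIndep_of_iSup_eq_top
    · exact M.isInternal.submodule_iSupIndep.comp (Equiv.addRight (1 : ℤ)).injective
    · rw [← M.isInternal.submodule_iSup_eq_top]
      exact (Equiv.addRight (1 : ℤ)).iSup_comp (g := M.deg)
  smul_mem i j m c hm hc := by
    have := M.smul_mem _ _ _ _ hm hc
    rwa [show i + 1 + j = i + j + 1 by ring] at this
  d := -M.d
  d_mem i m hm := (M.deg _).neg_mem (M.d_mem _ m hm)
  d_d m := by simp [M.d_d]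
  d_smul i m hm c := by
    simp only [LinearMap.neg_apply, M.d_smul _ m hm c, Int.negOnePow_succ, Units.neg_smul,
      smul_neg, neg_add, neg_neg]

/-- The shift functor on DG-modules; it does not change the underlying linear maps. -/
def shiftF : DGModule C ⥤ DGModule C where
  obj M := M.shift
  map {M N} f := ⟨f.1, fun i m hm => f.2.1 (i + 1) m hm, fun m => by
    change f.1 (-M.d m) = -N.d (f.1 m)
    rw [map_neg, f.2.2 m]⟩

/-- The mapping cone of a closed morphism `f : M ⟶ N`: the module `N ⊕ M[1]` with differential
`(n, m) ↦ (d n + f m, - d m)`. -/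
def cone {M N : DGModule C} (f : M ⟶ N) : DGModule C where
  carrier := N.carrier × M.carrier
  deg i := (N.deg i).prod (M.deg (i + 1))
  isInternal := by
    have hM := M.shift.isInternal
    have hN := N.isInternal
    apply DirectSum.isInternal_submodule_of_iSupIndep_of_iSup_eq_top
    · intro i
      rw [Submodule.disjoint_def]
      rintro ⟨n, m⟩ ⟨h₁, h₂⟩ h
      have hle : (⨆ j, ⨆ (_ : j ≠ i), (N.deg j).prod (M.deg (j + 1))) ≤
          (⨆ j, ⨆ (_ : j ≠ i), N.deg j).prod (⨆ j, ⨆ (_ : j ≠ i), M.deg (j + 1)) :=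
        iSup₂_le fun j hj => Submodule.prod_mono
          (le_iSup₂_of_le j hj le_rfl)
          (le_iSup₂_of_le (f := fun j (_ : j ≠ i) => M.deg (j + 1)) j hj le_rfl)
      obtain ⟨h₃, h₄⟩ := hle h
      have hn := Submodule.disjoint_def.1 (hN.submodule_iSupIndep i) n h₁ h₃
      have hm := Submodule.disjoint_def.1 (hM.submodule_iSupIndep i) m h₂ h₄
      exact Prod.ext hn hm
    · rw [eq_top_iff]
      rintro ⟨n, m⟩ -
      have hn : n ∈ ⨆ i, N.deg i := hN.submodule_iSup_eq_top ▸ Submodule.mem_top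
      have hM' : (⨆ i, M.deg (i + 1)) = ⊤ := hM.submodule_iSup_eq_top
      have hm : m ∈ ⨆ i, M.deg (i + 1) := hM' ▸ Submodule.mem_top
      have h₁ : (⨆ i, N.deg i) ≤ (⨆ i, (N.deg i).prod (M.deg (i + 1))).comap
          (LinearMap.inl ℂ N M) := iSup_le fun i x hx =>
        Submodule.mem_iSup_of_mem i ⟨hx, Submodule.zero_mem _⟩
      have h₂ : (⨆ i, M.deg (i + 1)) ≤ (⨆ i, (N.deg i).prod (M.deg (i + 1))).comap
          (LinearMap.inr ℂ N M) := iSup_le fun i x hx =>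
        Submodule.mem_iSup_of_mem i
          (show ((0, x) : N × M) ∈ _ from ⟨Submodule.zero_mem _, hx⟩)
      have h₃ : ((n, 0) : N × M) ∈ ⨆ i, (N.deg i).prod (M.deg (i + 1)) := h₁ hn
      have h₄ : ((0, m) : N × M) ∈ ⨆ i, (N.deg i).prod (M.deg (i + 1)) := @h₂ m hm
      simpa using Submodule.add_mem _ h₃ h₄
  smul_mem i j m c hm hc := by
    refine ⟨N.smul_mem _ _ _ _ hm.1 hc, ?_⟩
    have := M.smul_mem _ _ _ _ hm.2 hc
    rwa [show i + 1 + j = i + j + 1 by ring] at this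
  d :=
    { toFun := fun x => (N.d x.1 + f.1 x.2, -M.d x.2)
      map_add' := fun x y => by
        ext
        · simp only [Prod.fst_add, Prod.snd_add, map_add]; abel
        · simp only [Prod.snd_add, map_add]; abel
      map_smul' := fun a x => by
        ext
        · have h : f.1 (a • x.2) = a • f.1 x.2 := (f.1.restrictScalars ℂ).map_smul a x.2
          simp [h]
        · simp }
  d_mem i x hx := by
    refine ⟨(N.deg _).add_mem (N.d_mem _ _ hx.1) (f.2.1 _ _ hx.2), ?_⟩
    exact (M.deg _).neg_mem (M.d_mem _ _ hx.2)
  d_d x := by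
    ext
    · simp [N.d_d, f.2.2]
    · simp [M.d_d]
  d_smul i x hx c := by
    ext
    · simp only [LinearMap.coe_mk, AddHom.coe_mk, Prod.smul_fst, Prod.smul_snd, Prod.fst_add,
        N.d_smul _ _ hx.1 c, map_smul, smul_add]
      abel
    · simp only [LinearMap.coe_mk, AddHom.coe_mk, Prod.smul_snd, Prod.snd_add,
        M.d_smul _ _ hx.2 c, Int.negOnePow_succ, Units.neg_smul, smul_neg, neg_add, neg_neg]

/-- The inclusion `N ⟶ cone f`. -/
def coneInr {M N : DGModule C} (f : M ⟶ N) : N ⟶ cone f :=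
  ⟨LinearMap.inl _ N M, fun _ _ hn => ⟨hn, Submodule.zero_mem _⟩, fun n => by
    apply Prod.ext
    · change N.d n = N.d n + f.1 0
      simp
    · change (0 : M) = -M.d 0
      simp⟩

/-- The projection `cone f ⟶ M[1]`. -/
def coneProj {M N : DGModule C} (f : M ⟶ N) : cone f ⟶ M.shift :=
  ⟨LinearMap.snd _ N M, fun _ _ hx => hx.2, fun _ => rfl⟩

/-- A right DG-module is finite semi-free if, as a right `C`-module, it has a finite ordered basis
of homogeneous elements such that the differential of each basis element is a combination
of the previous ones. -/
def IsFiniteSemiFree (M : DGModule C) : Prop :=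
  ∃ (n : ℕ) (e : Module.Basis (Fin n) C.carrierᵐᵒᵖ M) (k : Fin n → ℤ),
    (∀ j, e j ∈ M.deg (k j)) ∧
    ∀ j, M.d (e j) ∈ Submodule.span C.carrierᵐᵒᵖ (e '' {i | i < j})

end DGModule

/-! ## The homotopy category of DG-modules and the category of perfect DG-modules -/

section Perf

variable (C : DGAlgebra.{w})

/-- The homotopy category of right DG-modules over `C`. -/
abbrev HoDG : Type _ := CategoryTheory.Quotient (DGModule.homotopic (C := C))

/-- The projection from DG-modules to the homotopy category. -/
abbrev HoDG.q : DGModule C ⥤ HoDG C := CategoryTheory.Quotient.functor _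

instance : Preadditive (HoDG C) :=
  CategoryTheory.Quotient.preadditive _ DGModule.homotopic_add

instance : (HoDG.q C).Additive :=
  CategoryTheory.Quotient.functor_additive _ DGModule.homotopic_add

instance : Linear ℂ (HoDG C) :=
  CategoryTheory.Quotient.linear ℂ _ DGModule.homotopic_smul

/-- The shift functor `[1]` on the homotopy category. -/
def HoDG.shiftF : HoDG C ⥤ HoDG C :=
  CategoryTheory.Quotient.lift _ (DGModule.shiftF ⋙ HoDG.q C) (by
    rintro M N f g ⟨h, hd, hh⟩
    apply CategoryTheory.Quotient.sound
    refine ⟨-h, fun i m hm => ?_, fun m => ?_⟩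
    · have := (N.deg _).neg_mem (hd _ m hm)
      rwa [show i + 1 - 1 = i - 1 + 1 by ring] at this
    · have key : ∀ x : M, f.1 x = g.1 x + (-N.d (-h x) + -h (-M.d x)) := fun x => by
        rw [hh]
        simp
      exact key m)

/-- Perfect DG-modules: direct summands, in the homotopy category, of finite semi-free ones.
(Such DG-modules are homotopically projective, so that morphisms between them in the homotopy
category and in the derived category agree.) -/
def isPerfect : ObjectProperty (HoDG C) := fun M =>
  ∃ P : DGModule C, P.IsFiniteSemiFree ∧ Nonempty (Retract M ((HoDG.q C).obj P))

/-- The derived category of perfect DG-modules over `C`. -/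
abbrev Perf : Type _ := (isPerfect C).FullSubcategory

end Perf

/-! ## DG-bimodules and smoothness -/

/-- A DG-bimodule over `C`. -/
structure DGBimodule (C : DGAlgebra.{w}) where
  carrier : Type w
  [addCommGroup : AddCommGroup carrier]
  [module : Module ℂ carrier]
  [leftModule : Module C.carrier carrier]
  [rightModule : Module C.carrierᵐᵒᵖ carrier]
  [leftTower : IsScalarTower ℂ C.carrier carrier]
  [rightTower : IsScalarTower ℂ C.carrierᵐᵒᵖ carrier]
  [smulComm : SMulCommClass C.carrier C.carrierᵐᵒᵖ carrier]
  deg : ℤ → Submodule ℂ carrier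
  isInternal : DirectSum.IsInternal deg
  left_mem : ∀ i j c m, c ∈ C.deg i → m ∈ deg j → c • m ∈ deg (i + j)
  right_mem : ∀ i j m c, m ∈ deg i → c ∈ C.deg j → MulOpposite.op c • m ∈ deg (i + j)
  d : carrier →ₗ[ℂ] carrier
  d_mem : ∀ i m, m ∈ deg i → d m ∈ deg (i + 1)
  d_d : ∀ m, d (d m) = 0
  d_left : ∀ i c, c ∈ C.deg i → ∀ m, d (c • m) = C.d c • m + i.negOnePow • c • d m
  d_right : ∀ i m, m ∈ deg i → ∀ c : C,
    d (MulOpposite.op c • m) = MulOpposite.op c • d m + i.negOnePow • MulOpposite.op (C.d c) • m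

attribute [instance] DGBimodule.addCommGroup DGBimodule.module DGBimodule.leftModule
  DGBimodule.rightModule DGBimodule.leftTower DGBimodule.rightTower DGBimodule.smulComm

namespace DGBimodule

variable {C : DGAlgebra.{w}}

instance : CoeSort (DGBimodule C) (Type w) := ⟨DGBimodule.carrier⟩

/-- The diagonal bimodule. -/
def diag (C : DGAlgebra.{w}) : DGBimodule C where
  carrier := C.carrier
  deg := C.deg
  isInternal := DirectSum.Decomposition.isInternal C.deg
  left_mem _ _ _ _ hc hm := SetLike.mul_mem_graded hc hm
  right_mem _ _ _ _ hm hc := SetLike.mul_mem_graded hm hc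
  d := C.d
  d_mem := C.d_mem
  d_d := C.d_d
  d_left := C.d_mul
  d_right := C.d_mul

/-- Closed morphisms of degree `0` between DG-bimodules. -/
structure Hom (M N : DGBimodule C) where
  toFun : M →ₗ[ℂ] N
  map_left : ∀ (c : C) m, toFun (c • m) = c • toFun m
  map_right : ∀ (c : C) m, toFun (MulOpposite.op c • m) = MulOpposite.op c • toFun m
  map_deg : ∀ i m, m ∈ M.deg i → toFun m ∈ N.deg i
  map_d : ∀ m, toFun (M.d m) = N.d (toFun m)

/-- A morphism of DG-bimodules is a quasi-isomorphism if it is injective and surjective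
on cohomology. -/
def Hom.IsQuasiIso {M N : DGBimodule C} (f : Hom M N) : Prop :=
  (∀ m, M.d m = 0 → f.toFun m ∈ LinearMap.range N.d → m ∈ LinearMap.range M.d) ∧
  ∀ n, N.d n = 0 → ∃ m, M.d m = 0 ∧ f.toFun m - n ∈ LinearMap.range N.d

/-- `P` is a direct summand of `Q` up to homotopy: there are closed morphisms
`a : P ⟶ Q` and `b : Q ⟶ P` with `b a - 1 = d h + h d`, where `h` is a map of bimodules
of degree `-1` (Koszul signs for the left action). -/
def IsHomotopyRetract (P Q : DGBimodule C) : Prop :=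
  ∃ (a : Hom P Q) (b : Hom Q P) (h : P →ₗ[ℂ] P),
    (∀ i m, m ∈ P.deg i → h m ∈ P.deg (i - 1)) ∧
    (∀ i c, c ∈ C.deg i → ∀ m, h (c • m) = i.negOnePow • c • h m) ∧
    (∀ (c : C) m, h (MulOpposite.op c • m) = MulOpposite.op c • h m) ∧
    ∀ m, b.toFun (a.toFun m) = m + (P.d (h m) + h (P.d m))

/-- The map `C ⊗ C → M`, `c ⊗ c' ↦ c m c'`. -/
def act (M : DGBimodule C) (m : M) : C ⊗[ℂ] C →ₗ[ℂ] M :=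
  TensorProduct.lift (LinearMap.mk₂ ℂ (fun c c' : C => c • MulOpposite.op c' • m)
    (fun c₁ c₂ c' => add_smul _ _ _)
    (fun a c c' => smul_assoc _ _ _)
    (fun c c₁ c₂ => by rw [MulOpposite.op_add, add_smul, smul_add])
    (fun a c c' => by
      rw [MulOpposite.op_smul, smul_assoc, ← algebraMap_smul C a (MulOpposite.op c' • m),
        ← mul_smul, ← Algebra.commutes, mul_smul, algebraMap_smul]))

/-- A DG-bimodule is finite semi-free if it has finitely many homogeneous elements `e₁, …, eₙ`
such that every element is `∑ xᵢ · eᵢ` for a unique family `xᵢ ∈ C ⊗ C`, and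
`d eⱼ ∈ ∑_{i < j} C eᵢ C`. -/
def IsFiniteSemiFree (M : DGBimodule C) : Prop :=
  ∃ (n : ℕ) (e : Fin n → M) (k : Fin n → ℤ),
    (∀ j, e j ∈ M.deg (k j)) ∧
    (∀ m : M, ∃! x : Fin n → C ⊗[ℂ] C, ∑ j, M.act (e j) (x j) = m) ∧
    ∀ j, M.d (e j) ∈ ⨆ i : {i // i < j}, LinearMap.range (M.act (e i))

end DGBimodule

/-- A DG-algebra is smooth if its diagonal bimodule is perfect, that is, quasi-isomorphic to a
direct summand, up to homotopy, of a finite semi-free bimodule. -/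
def DGAlgebra.IsSmooth (C : DGAlgebra.{w}) : Prop :=
  ∃ (P Q : DGBimodule C) (f : DGBimodule.Hom P (DGBimodule.diag C)),
    f.IsQuasiIso ∧ Q.IsFiniteSemiFree ∧ P.IsHomotopyRetract Q

/-! ## Hochschild homology -/

section Hochschild

variable (C : DGAlgebra.{w})

/-- The linear endomorphism multiplying the component of degree `i` by the integer `s i`. -/
def DGAlgebra.weight (s : ℤ → ℤ) : C →ₗ[ℂ] C :=
  (DirectSum.toModule ℂ ℤ C fun i => s i • (C.deg i).subtype) ∘ₗ
    (DirectSum.decomposeLinearEquiv C.deg).toLinearMap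

/-- `a ↦ (-1)^{|a|} a`. -/
def DGAlgebra.sgn : C →ₗ[ℂ] C := C.weight fun i => (i.negOnePow : ℤ)

/-- The projection to the part of even degree. -/
def DGAlgebra.evenPart : C →ₗ[ℂ] C := C.weight fun i => if Even i then 1 else 0

/-- The projection to the part of odd degree. -/
def DGAlgebra.oddPart : C →ₗ[ℂ] C := C.weight fun i => if Even i then 0 else 1

/-- The tensor power `C ⊗ C^{⊗ n}`, with factors numbered `0, …, n`. -/
abbrev HochTensor (n : ℕ) : Type w := ⨂[ℂ] _ : Fin (n + 1), C.carrier

variable {C}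

lemma contract_update {n : ℕ} (i : Fin (n + 1)) (a : Fin (n + 2) → C) (p : Fin (n + 2)) :
    ∃ (q : Fin (n + 1)) (L : C →ₗ[ℂ] C), ∀ x,
      Fin.contractNth i.castSucc (· * ·) (Function.update a p x) =
        Function.update (Fin.contractNth i.castSucc (· * ·) a) q (L x) := by
  have hi := i.2
  have hp := p.2
  rcases lt_trichotomy (p : ℕ) i with h | h | h
  · refine ⟨⟨p, by omega⟩, LinearMap.id, fun x => funext fun k => ?_⟩
    simp only [Fin.contractNth, Function.update_apply, Fin.ext_iff, Fin.val_castSucc, Fin.val_succ,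
      LinearMap.id_apply]
    split_ifs <;> first | rfl | omega
  · refine ⟨i, LinearMap.mulRight ℂ (a i.succ), fun x => funext fun k => ?_⟩
    simp only [Fin.contractNth, Function.update_apply, Fin.ext_iff, Fin.val_castSucc, Fin.val_succ,
      LinearMap.mulRight_apply]
    split_ifs with h1 h2 h3 h4 h5 h6 h7 <;> first
      | rfl
      | omega
      | (have : k = i := Fin.ext (by omega)
         subst this; rfl)
  · by_cases h' : (p : ℕ) = i + 1
    · refine ⟨i, LinearMap.mulLeft ℂ (a i.castSucc), fun x => funext fun k => ?_⟩
      simp only [Fin.contractNth, Function.update_apply, Fin.ext_iff, Fin.val_castSucc,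
        Fin.val_succ, LinearMap.mulLeft_apply]
      split_ifs with h1 h2 h3 h4 h5 h6 h7 <;> first
        | rfl
        | omega
        | (have : k = i := Fin.ext (by omega)
           subst this; rfl)
    · refine ⟨⟨p - 1, by omega⟩, LinearMap.id, fun x => funext fun k => ?_⟩
      simp only [Fin.contractNth, Function.update_apply, Fin.ext_iff, Fin.val_castSucc,
        Fin.val_succ, LinearMap.id_apply]
      split_ifs <;> first | rfl | omega

variable (C)

/-- The map `a₀ ⊗ ⋯ ⊗ a_{n+1} ↦ a₀ ⊗ ⋯ ⊗ aᵢ aᵢ₊₁ ⊗ ⋯ ⊗ a_{n+1}`. -/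
def HochTensor.mulAt (n : ℕ) (i : Fin (n + 1)) : HochTensor C (n + 1) →ₗ[ℂ] HochTensor C n :=
  PiTensorProduct.lift (MultilinearMap.mk'
    (fun a => PiTensorProduct.tprod ℂ (Fin.contractNth i.castSucc (· * ·) a))
    (fun a p x y => by
      obtain ⟨q, L, h⟩ := contract_update i a p
      rw [h, h, h, map_add, MultilinearMap.map_update_add])
    (fun a p c x => by
      obtain ⟨q, L, h⟩ := contract_update i a p
      rw [h, h, map_smul, MultilinearMap.map_update_smul]))

/-- The rotation `a₀ ⊗ ⋯ ⊗ aₙ ↦ aₙ ⊗ a₀ ⊗ ⋯ ⊗ aₙ₋₁` (without sign). -/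
def HochTensor.rotate (n : ℕ) : HochTensor C n →ₗ[ℂ] HochTensor C n :=
  (PiTensorProduct.reindex ℂ (fun _ => C.carrier) (finRotate (n + 1))).toLinearMap

/-- The part of the Hochschild differential induced by the differential of `C`. With
`εᵢ = |a₀| + ∑_{1 ≤ j ≤ i} (|aⱼ| - 1)` it maps `a₀ ⊗ ⋯ ⊗ aₙ` to
`d a₀ ⊗ ⋯ ⊗ aₙ - ∑_{i ≥ 1} (-1)^{εᵢ₋₁} a₀ ⊗ ⋯ ⊗ d aᵢ ⊗ ⋯ ⊗ aₙ`. -/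
def HochTensor.dInt (n : ℕ) : HochTensor C n →ₗ[ℂ] HochTensor C n :=
  ∑ i : Fin (n + 1), ((-1 : ℤ) ^ (i : ℕ)) •
    PiTensorProduct.map fun j => if j < i then C.sgn else if j = i then C.d else LinearMap.id

/-- The part of the Hochschild differential induced by the product of `C`. It maps
`a₀ ⊗ ⋯ ⊗ aₙ₊₁` to `∑_{0 ≤ i ≤ n} (-1)^{εᵢ} a₀ ⊗ ⋯ ⊗ aᵢ aᵢ₊₁ ⊗ ⋯ ⊗ aₙ₊₁
 - (-1)^{εₙ (|aₙ₊₁| - 1)} aₙ₊₁ a₀ ⊗ a₁ ⊗ ⋯ ⊗ aₙ`; the last sign is `(-1)^{εₙ}` when `|aₙ₊₁|` is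
even, and `1` when it is odd. -/
def HochTensor.dMul (n : ℕ) : HochTensor C (n + 1) →ₗ[ℂ] HochTensor C n :=
  (∑ i : Fin (n + 1), ((-1 : ℤ) ^ (i : ℕ)) •
    (HochTensor.mulAt C n i ∘ₗ
      PiTensorProduct.map fun j => if j ≤ i.castSucc then C.sgn else LinearMap.id)) -
  HochTensor.mulAt C n 0 ∘ₗ HochTensor.rotate C (n + 1) ∘ₗ
    (((-1 : ℤ) ^ n) •
        (PiTensorProduct.map fun j => if j = Fin.last (n + 1) then C.evenPart else C.sgn) +
      PiTensorProduct.map fun j => if j = Fin.last (n + 1) then C.oddPart else LinearMap.id)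

/-- The Hochschild chain complex of `C`, as a total space. -/
def HochComplex : Type w := ⨁ n : ℕ, HochTensor C n

instance : AddCommMonoid (HochComplex C) :=
  inferInstanceAs (AddCommMonoid (⨁ n : ℕ, HochTensor C n))

instance : Module ℂ (HochComplex C) :=
  inferInstanceAs (Module ℂ (⨁ n : ℕ, HochTensor C n))

instance : AddCommGroup (HochComplex C) := Module.addCommMonoidToAddCommGroup ℂ

/-- The inclusion of the summand `C ⊗ C^{⊗ n}`. -/
def HochComplex.incl (n : ℕ) : HochTensor C n →ₗ[ℂ] HochComplex C :=
  DirectSum.lof ℂ ℕ (HochTensor C) n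

/-- The Hochschild differential. -/
def HochComplex.d : HochComplex C →ₗ[ℂ] HochComplex C :=
  DirectSum.toModule ℂ ℕ _ fun n =>
    HochComplex.incl C n ∘ₗ HochTensor.dInt C n +
    match n with
    | 0 => 0
    | n + 1 => HochComplex.incl C n ∘ₗ HochTensor.dMul C n

/-- The part of cohomological degree `k` of the Hochschild complex, where `a₀ ⊗ ⋯ ⊗ aₙ` has
degree `|a₀| + ⋯ + |aₙ| - n`. -/
def HochComplex.deg (k : ℤ) : Submodule ℂ (HochComplex C) :=
  Submodule.span ℂ {x | ∃ (n : ℕ) (s : Fin (n + 1) → ℤ) (a : Fin (n + 1) → C),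
    (∀ j, a j ∈ C.deg (s j)) ∧ ∑ j, s j - n = k ∧
    x = HochComplex.incl C n (PiTensorProduct.tprod ℂ a)}

/-- The cycles of homological degree `m`. -/
def hochCycles (m : ℤ) : Submodule ℂ (HochComplex C) :=
  LinearMap.ker (HochComplex.d C) ⊓ HochComplex.deg C (-m)

/-- The boundaries of homological degree `m`. -/
def hochBoundaries (m : ℤ) : Submodule ℂ (HochComplex C) :=
  (HochComplex.deg C (-m - 1)).map (HochComplex.d C)

/-- The Hochschild homology `HH_m(C)`. -/
abbrev HochschildHomology (m : ℤ) : Type w :=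
  hochCycles C m ⧸ (hochBoundaries C m).comap (hochCycles C m).subtype

end Hochschild

/-! ## Smooth proper triangulated categories and the Calabi-Yau condition -/

section Triangulated

variable (A : Type u) [Category.{v} A] [Preadditive A] [Linear ℂ A] [HasZeroObject A]
  [HasShift A ℤ] [∀ n : ℤ, (shiftFunctor A n).Additive] [Pretriangulated A]

/-- A triangle `X → Y → Z → X[1]` in the homotopy category of DG-modules is distinguished if it is
isomorphic to the triangle of a mapping cone. -/
def HoDG.IsDistinguished {C : DGAlgebra.{w}} {X Y Z : HoDG C} (f : X ⟶ Y) (g : Y ⟶ Z)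
    (h : Z ⟶ (HoDG.shiftF C).obj X) : Prop :=
  ∃ (M N : DGModule C) (φ : M ⟶ N)
    (α : X ≅ (HoDG.q C).obj M) (β : Y ≅ (HoDG.q C).obj N)
    (γ : Z ≅ (HoDG.q C).obj (DGModule.cone φ)),
    f ≫ β.hom = α.hom ≫ (HoDG.q C).map φ ∧
    g ≫ γ.hom = β.hom ≫ (HoDG.q C).map (DGModule.coneInr φ) ∧
    h ≫ (HoDG.shiftF C).map α.hom = γ.hom ≫ (HoDG.q C).map (DGModule.coneProj φ)

/-- A realization of the `ℂ`-linear triangulated category `A` as the derived category of perfect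
DG-modules over a smooth and proper DG-algebra: an exact `ℂ`-linear equivalence. -/
structure SmoothProperRealization where
  C : DGAlgebra.{w}
  smooth : C.IsSmooth
  proper : C.IsProper
  equiv : A ≌ Perf C
  [additive : equiv.functor.Additive]
  [linear : equiv.functor.Linear ℂ]
  shiftIso : shiftFunctor A (1 : ℤ) ⋙ equiv.functor ⋙ (isPerfect C).ι ≅
    (equiv.functor ⋙ (isPerfect C).ι) ⋙ HoDG.shiftF C
  exact : ∀ T ∈ Pretriangulated.distinguishedTriangles (C := A),
    HoDG.IsDistinguished
      ((equiv.functor ⋙ (isPerfect C).ι).map T.mor₁)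
      ((equiv.functor ⋙ (isPerfect C).ι).map T.mor₂)
      ((equiv.functor ⋙ (isPerfect C).ι).map T.mor₃ ≫ shiftIso.hom.app T.obj₁)

/-- `A` is Calabi-Yau of dimension `p`: the shift `[p]` is a Serre functor, i.e. there are
isomorphisms `Hom(X, Y) ≃ Hom(Y, X[p])^*`, natural in `X` and `Y`. -/
def IsCalabiYau (p : ℤ) : Prop :=
  ∃ η : ∀ X Y : A, (X ⟶ Y) ≃ₗ[ℂ] Module.Dual ℂ (Y ⟶ X⟦p⟧),
    (∀ (X Y Y' : A) (f : X ⟶ Y) (g : Y ⟶ Y') (h : Y' ⟶ X⟦p⟧),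
      η X Y' (f ≫ g) h = η X Y f (g ≫ h)) ∧
    ∀ (X' X Y : A) (e : X' ⟶ X) (f : X ⟶ Y) (h : Y ⟶ X'⟦p⟧),
      η X' Y (e ≫ f) h = η X Y f (h ≫ e⟦p⟧')

/-! ## K-theory -/

/-- The relations `[Y] = [X] + [Z]` for all distinguished triangles `X → Y → Z → X[1]`. -/
def kRelations : AddSubgroup (FreeAbelianGroup A) :=
  AddSubgroup.closure {x | ∃ T ∈ Pretriangulated.distinguishedTriangles (C := A),
    x = FreeAbelianGroup.of T.obj₂ - FreeAbelianGroup.of T.obj₁ - FreeAbelianGroup.of T.obj₃}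

/-- The Grothendieck group `K₀(A)`. -/
abbrev K0 : Type u := FreeAbelianGroup A ⧸ kRelations A

variable {A}

/-- The class of an object in `K₀(A)`. -/
def cl (F : A) : K0 A := QuotientAddGroup.mk (FreeAbelianGroup.of F)

/-- The Euler pairing `χ(E, F) = ∑_k (-1)^k dim Ext^k(E, F)`, over all integers `k` (a finite sum
when `A` is proper). -/
def euler (E F : A) : ℤ :=
  ∑ᶠ k : ℤ, (k.negOnePow : ℤ) * (Module.finrank ℂ (ShiftedHom E F k) : ℤ)

variable (A)

/-- The formal combinations `x` of objects with `χ(x, F) = 0` for all objects `F`. -/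
def eulerKernel : AddSubgroup (FreeAbelianGroup A) :=
  ⨅ F : A, (FreeAbelianGroup.lift fun E : A => euler E F).ker

/-- The numerical K-theory of `A`: the quotient of `K₀(A)` by the kernel of the Euler pairing,
which is the image in `K₀(A)` of the kernel of `χ` on formal combinations of objects. -/
abbrev KNum : Type u :=
  K0 A ⧸ (eulerKernel A).map (QuotientAddGroup.mk' (kRelations A))

variable {A}

/-- The class of an object in numerical K-theory. -/
def clNum (F : A) : KNum A := QuotientAddGroup.mk (cl F)

/-- The classes of the objects in `S` generate `K₀(A) ⊗ ℂ`. -/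
def GeneratesK0 (S : Set A) : Prop :=
  Submodule.span ℂ ((fun F : A => (1 : ℂ) ⊗ₜ[ℤ] cl F) '' S) = (⊤ : Submodule ℂ (ℂ ⊗[ℤ] K0 A))

/-- The classes of the objects in `S` generate `K_num(A) ⊗ ℂ`. -/
def GeneratesKNum (S : Set A) : Prop :=
  Submodule.span ℂ ((fun F : A => (1 : ℂ) ⊗ₜ[ℤ] clNum F) '' S) =
    (⊤ : Submodule ℂ (ℂ ⊗[ℤ] KNum A))

/-! ## Rank functions, homological units and unitary objects -/

variable (A)

/-- Rank functions: integral functions of objects, additive on distinguished triangles and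
changing sign under the shift. -/
structure RankFunction where
  rk : A → ℤ
  additive : ∀ T ∈ Pretriangulated.distinguishedTriangles (C := A),
    rk T.obj₂ = rk T.obj₁ + rk T.obj₃
  shift : ∀ F : A, rk (F⟦(1 : ℤ)⟧) = -rk F

variable {A}

/-- A rank function is non-trivial if it is not the zero function. -/
def RankFunction.IsNontrivial (r : RankFunction A) : Prop := ∃ F, r.rk F ≠ 0

/-- A rank function is numerical if it descends to `K_num(A)`. -/
def RankFunction.IsNumerical (r : RankFunction A) : Prop :=
  ∃ φ : KNum A →+ ℤ, ∀ F, φ (clNum F) = r.rk F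

/-- The data required of a homological unit with respect to `r`, apart from maximality: for every
object `F`, a morphism of graded algebras `i_F : T^• → Hom^•(F, F)`, natural in `F`, and a
morphism of graded vector spaces `t_F : Hom^•(F, F) → T^•` with `t_F (i_F a) = r(F) a`.
The product of `Hom^•(F, F)` is the composition: `f · g = f[|g|] ∘ g`. -/
def HasUnitMaps (r : RankFunction A) {T : Type t} [Ring T] [Algebra ℂ T]
    (𝒯 : ℤ → Submodule ℂ T) [GradedAlgebra 𝒯] : Prop :=
  ∃ (i : ∀ (F : A) (k : ℤ), 𝒯 k →ₗ[ℂ] ShiftedHom F F k)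
    (τ : ∀ (F : A) (k : ℤ), ShiftedHom F F k →ₗ[ℂ] 𝒯 k),
    (∀ F, i F 0 ⟨1, SetLike.one_mem_graded 𝒯⟩ = ShiftedHom.mk₀ 0 rfl (𝟙 F)) ∧
    (∀ (F : A) (k l : ℤ) (a : 𝒯 k) (b : 𝒯 l),
      i F (k + l) ⟨a * b, SetLike.mul_mem_graded a.2 b.2⟩ = (i F l b).comp (i F k a) rfl) ∧
    (∀ (F G : A) (ψ : F ⟶ G) (k : ℤ) (a : 𝒯 k), i F k a ≫ ψ⟦k⟧' = ψ ≫ i G k a) ∧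
    ∀ (F : A) (k : ℤ) (a : 𝒯 k), τ F k (i F k a) = r.rk F • a

/-- A homological unit for `A` with respect to `r`: a graded algebra `T^•` which is maximal among
those satisfying `HasUnitMaps`, i.e. every injective morphism of graded algebras from `T^•` to
another one is bijective. -/
def IsHomologicalUnit (r : RankFunction A) {T : Type t} [Ring T] [Algebra ℂ T]
    (𝒯 : ℤ → Submodule ℂ T) [GradedAlgebra 𝒯] : Prop :=
  HasUnitMaps r 𝒯 ∧
  ∀ (T' : Type t) [Ring T'] [Algebra ℂ T'] (𝒯' : ℤ → Submodule ℂ T') [GradedAlgebra 𝒯'],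
    HasUnitMaps r 𝒯' → ∀ f : T →ₐ[ℂ] T', (∀ k a, a ∈ 𝒯 k → f a ∈ 𝒯' k) →
      Function.Injective f → Function.Bijective f

/-- `F` is unitary with respect to `T^•` if `Hom^•(F, F) ≃ T^•` as graded rings. -/
def IsUnitary {T : Type t} [Ring T] [Algebra ℂ T] (𝒯 : ℤ → Submodule ℂ T) [GradedAlgebra 𝒯]
    (F : A) : Prop :=
  ∃ φ : ∀ k : ℤ, ShiftedHom F F k ≃+ 𝒯 k,
    φ 0 (ShiftedHom.mk₀ 0 rfl (𝟙 F)) = ⟨1, SetLike.one_mem_graded 𝒯⟩ ∧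
    ∀ (k l : ℤ) (f : ShiftedHom F F k) (g : ShiftedHom F F l),
      φ (k + l) (g.comp f rfl) = ⟨φ k f * φ l g, SetLike.mul_mem_graded (φ k f).2 (φ l g).2⟩

end Triangulated

/-! ## The algebra `ℂ ⊕ ℂ[3]` and Hodge numbers -/

/-- The grading on `ℂ ⊕ ℂ ε` (`ε² = 0`) with `1` in degree `0` and `ε` in degree `3`. -/
def sphereGrading (k : ℤ) : Submodule ℂ (TrivSqZeroExt ℂ ℂ) :=
  if k = 0 then LinearMap.range (TrivSqZeroExt.inlAlgHom ℂ ℂ ℂ).toLinearMap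
  else if k = 3 then LinearMap.range (TrivSqZeroExt.inrHom ℂ ℂ)
  else ⊥

/-- `T^• = ℂ ⊕ ℂ[3]` as graded algebras (one copy of `ℂ` in degree `0`, one in degree `3`). -/
def IsSphereAlgebra {T : Type t} [Ring T] [Algebra ℂ T] (𝒯 : ℤ → Submodule ℂ T) : Prop :=
  ∃ φ : T ≃ₐ[ℂ] TrivSqZeroExt ℂ ℂ, ∀ k, (𝒯 k).map φ.toLinearMap = sphereGrading k

/-- The Hodge numbers attached to a graded algebra `T^•` and to the Hochschild homology of `C`:
`h^{i,0} = h^{0,i} = dim T^{3-i}`, `h^{3,1} = h^{1,3} = dim HH_{-2} - h^{2,0}`,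
`h^{3,2} = h^{2,3} = h^{1,0}`, `h^{2,1} = h^{1,2} = dim HH_{-1} - h^{1,0} - h^{3,2}`,
`h^{3,3} = h^{0,0}` and `h^{1,1} = h^{2,2} = (dim HH_0 - h^{0,0} - h^{3,3}) / 2`. -/
def hodgeNumber (C : DGAlgebra.{w}) {T : Type t} [Ring T] [Algebra ℂ T]
    (𝒯 : ℤ → Submodule ℂ T) (p q : Fin 4) : ℚ :=
  let h0 : ℤ → ℚ := fun i => Module.finrank ℂ (𝒯 (3 - i))
  let hh : ℤ → ℚ := fun m => Module.finrank ℂ (HochschildHomology C m)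
  match p, q with
  | 0, 0 => h0 0
  | 1, 0 | 0, 1 => h0 1
  | 2, 0 | 0, 2 => h0 2
  | 3, 0 | 0, 3 => h0 3
  | 3, 1 | 1, 3 => hh (-2) - h0 2
  | 3, 2 | 2, 3 => h0 1
  | 2, 1 | 1, 2 => hh (-1) - h0 1 - h0 1
  | 3, 3 => h0 0
  | 1, 1 | 2, 2 => (hh 0 - h0 0 - h0 0) / 2

end CYHodge

end

/-! If `rk F ≠ 0`, the identity `t_F (i_F a) = rk(F) a` makes `i_F` injective, so `T^k` embeds into
`Hom^k(F, F)`. If `F` is unitary for `T₁` and has nonzero second rank, then `T₂^k` embeds into a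
space of dimension `dim T₁^k`, so `dim T₂^k ≤ dim T₁^k` (`HasUnitMaps.finrank_le`). The generation
hypothesis produces such an `F`: a nontrivial rank function that factors through `K` extends to a
nonzero linear form on `K ⊗ ℂ`, which cannot vanish on a generating set
(`RankFunction.exists_mem_rk_ne_zero`). In (a) the argument is symmetric, and the Hodge numbers
depend on `T^•` only through the dimensions of its graded pieces.

In (b) only one inequality comes this way; it forces `T₂^k = 0` for `k ≠ 0, 3` and `dim T₂^k ≤ 1`
otherwise. The unit gives `T₂^0 ≠ 0`, and Serre duality on a unitary object `G` for `T₂` gives `dim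
T₂^3 = dim Hom^3(G, G) = dim Hom^0(G, G) = dim T₂^0`.

Two points need care. Unitarity is an isomorphism of graded rings, not of `ℂ`-algebras, so
dimensions must be read off from the ring structure: naturality of `i` makes `T^0` commutative, and
over a commutative `ℂ`-algebra the dimension of a finite-dimensional module is its length, which
does not see the `ℂ`-structure (`IsUnitary.finrank_eq`). Finiteness of the `Hom` spaces comes from
Serre duality applied twice, since a space isomorphic to its bidual is finite dimensional. -/

/-! ### Dimension as length, and infinite-dimensional duality -/

/-- Over a commutative algebra over an algebraically closed field `k`, the length of a module which
is finite dimensional over `k` is its dimension. -/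
theorem Module.length_eq_finrank_of_isAlgClosed (k R : Type*) [Field k] [IsAlgClosed k] [Ring R]
    [IsMulCommutative R] [Algebra k R] (n : ℕ) :
    ∀ (M : Type*) [AddCommGroup M] [Module k M] [Module R M] [IsScalarTower k R M]
      [FiniteDimensional k M], Module.finrank k M = n → Module.length R M = n := by
  induction n with
  | zero =>
    intro M _ _ _ _ _ h
    have := Module.finrank_zero_iff.1 h
    simp [Module.length_eq_zero]
  | succ n ih =>
    intro M _ _ _ _ _ h
    have : Nontrivial M := Module.nontrivial_of_finrank_pos (R := k) (by omega)
    have : IsArtinian R M := isArtinian_of_tower k inferInstance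
    obtain ⟨N, hN⟩ := IsAtomic.exists_atom (α := Submodule R M)
    rw [← isSimpleModule_iff_isAtom] at hN
    have : FiniteDimensional k N :=
      inferInstanceAs (FiniteDimensional k (N.restrictScalars k))
    -- Schur: since `R` is commutative it acts on the simple module `N` by endomorphisms, which are
    -- scalars because `k` is algebraically closed, so `N` is a line. Splitting it off lowers
    -- dimension and length by one each.
    have h₁ : Module.finrank k N = 1 := IsSimpleModule.finrank_eq_one_of_isMulCommutative R N k
    have h₂ : Module.finrank k (M ⧸ N) + Module.finrank k N = Module.finrank k M :=
      Submodule.finrank_quotient_add_finrank (N.restrictScalars k)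
    have : FiniteDimensional k (M ⧸ N) :=
      inferInstanceAs (FiniteDimensional k (M ⧸ N.restrictScalars k))
    rw [Module.length_eq_add_of_exact N.subtype N.mkQ N.injective_subtype N.mkQ_surjective
      (LinearMap.exact_subtype_mkQ N), ih (M ⧸ N) (by omega), Module.length_eq_one]
    push_cast
    rw [add_comm]

/-- If a vector space `V` over an algebraically closed field `k` is identified with a module over a
commutative ring `R` in such a way that `k` acts through `R`, its dimension is the length over `R`,
and does not depend on the identification. -/
theorem Module.length_eq_finrank_of_semilinear {k R M V : Type*} [Field k] [IsAlgClosed k] [Ring R]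
    [IsMulCommutative R] [AddCommGroup M] [Module R M] [AddCommGroup V] [Module k V]
    [FiniteDimensional k V] (σ : k →+* R) (e : V ≃+ M) (h : ∀ c v, e (c • v) = σ c • e v) :
    Module.length R M = Module.finrank k V := by
  -- `k` acts on `R` through `σ` and on `M` by transport along `e`; hypothesis `h` is exactly the
  -- compatibility of these two actions.
  let : Algebra k R := σ.toAlgebra' fun c x => mul_comm' (σ c) x
  let : Module k M := e.symm.module k
  let e' : V ≃ₗ[k] M := e.toLinearEquiv fun c v => by
    change e (c • v) = e (c • e.symm (e v))
    rw [e.symm_apply_apply]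
  have : IsScalarTower k R M := ⟨fun c r m => by
    change (σ c * r) • m = e (c • e.symm (r • m))
    rw [h, e.apply_symm_apply, mul_smul]⟩
  have : FiniteDimensional k M := Module.Finite.equiv e'
  exact Module.length_eq_finrank_of_isAlgClosed k R _ M e'.finrank_eq.symm

/-- A vector space which is isomorphic to its bidual is finite dimensional. -/
theorem FiniteDimensional.of_equiv_dual_dual {K V : Type*} [Field K] [AddCommGroup V] [Module K V]
    (e : V ≃ₗ[K] Module.Dual K (Module.Dual K V)) : FiniteDimensional K V := by
  rw [FiniteDimensional, ← Module.rank_lt_aleph0_iff]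
  by_contra! h
  -- Dualizing strictly increases an infinite dimension, so doing it twice cannot return to the
  -- dimension of `V`.
  have h₁ := lift_rank_lt_rank_dual h
  have h₂ := lift_rank_lt_rank_dual (K := K) (V := Module.Dual K V)
    (Cardinal.aleph0_le_lift.2 h |>.trans h₁.le)
  have h₃ := e.lift_rank_eq
  rw [Cardinal.lift_id'] at h₂
  rw [← Cardinal.lift_umax, h₃, Cardinal.lift_id'] at h₁
  exact lt_asymm h₁ h₂

namespace CYHodge

/-- A linear map is injective if it has a left inverse up to a nonzero integer. -/
theorem injective_of_leftInverse_smul {V W : Type*} [AddCommGroup V] [Module ℂ V]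
    [AddCommGroup W] [Module ℂ W] {n : ℤ} (hn : n ≠ 0) (f : V →ₗ[ℂ] W) (g : W →ₗ[ℂ] V)
    (h : ∀ a, g (f a) = n • a) : Function.Injective f := by
  refine (injective_iff_map_eq_zero _).2 fun a ha => ?_
  have h₁ := h a
  rw [ha, map_zero, ← Int.cast_smul_eq_zsmul ℂ] at h₁
  exact (smul_eq_zero.1 h₁.symm).resolve_left (Int.cast_ne_zero.2 hn)

/-! ### The action of the degree `0` part on the homogeneous components -/

section GradeZero

variable {T : Type t} [Ring T] [Algebra ℂ T] (𝒯 : ℤ → Submodule ℂ T) [GradedAlgebra 𝒯]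

/-- A homogeneous component of a graded algebra is a module over the component of degree `0`. -/
@[reducible] def gradeZeroModule (k : ℤ) : Module (𝒯 0) (𝒯 k) where
  smul a b := ⟨a * b, by simpa using SetLike.mul_mem_graded a.2 b.2⟩
  one_smul b := Subtype.ext (one_mul (b : T))
  mul_smul a b c := Subtype.ext (mul_assoc (a : T) b c)
  smul_zero a := Subtype.ext (mul_zero (a : T))
  smul_add a b c := Subtype.ext (mul_add (a : T) b c)
  add_smul a b c := Subtype.ext (add_mul (a : T) b c)
  zero_smul b := Subtype.ext (zero_mul (b : T))

end GradeZero

/-! ### Rank functions on Grothendieck groups -/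

section RankFunction

variable {A : Type u} [Category.{v} A] [Preadditive A] [HasZeroObject A]
  [HasShift A ℤ] [∀ n : ℤ, (shiftFunctor A n).Additive] [Pretriangulated A]

/-- The contractible triangle `F → F → 0` is isomorphic to one with all three vertices `F`, and
additivity there reads `rk F = rk F + rk F`. -/
theorem RankFunction.rk_eq_zero_of_isZero (r : RankFunction A) {F : A} (hF : IsZero F) :
    r.rk F = 0 := by
  have h := r.additive (Pretriangulated.Triangle.mk (𝟙 F) (0 : F ⟶ F) 0)
    (Pretriangulated.isomorphic_distinguished _ (Pretriangulated.contractible_distinguished F) _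
      (Pretriangulated.Triangle.isoMk _ _ (Iso.refl F) (Iso.refl F) hF.isoZero
        (hF.eq_of_src _ _) (hF.eq_of_src _ _) (hF.eq_of_src _ _)))
  simpa using h

/-- If the classes of the objects of `S` generate `K ⊗ ℂ` and a nontrivial rank function factors
through the group `K`, it does not vanish on `S`. -/
theorem RankFunction.exists_mem_rk_ne_zero {r : RankFunction A} (hr : r.IsNontrivial) {K : Type*}
    [AddCommGroup K] (c : A → K) (φ : K →+ ℤ) (hφ : ∀ F, φ (c F) = r.rk F) {S : Set A}
    (hS : Submodule.span ℂ ((fun F : A => (1 : ℂ) ⊗ₜ[ℤ] c F) '' S) =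
      (⊤ : Submodule ℂ (ℂ ⊗[ℤ] K))) : ∃ F ∈ S, r.rk F ≠ 0 := by
  by_contra! h
  let Φ : ℂ ⊗[ℤ] K →ₗ[ℂ] ℂ ⊗[ℤ] ℤ := φ.toIntLinearMap.baseChange ℂ
  have hΦ : Φ = 0 := by
    refine LinearMap.ext_on hS ?_
    rintro _ ⟨F, hF, rfl⟩
    simp [Φ, hφ, h F hF]
  obtain ⟨F, hF⟩ := hr
  -- Under `ℂ ⊗ ℤ ≃ ℂ` the value of `Φ` at `1 ⊗ c F` is the complex number `rk F`, nonzero in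
  -- characteristic zero.
  have h₁ := congr(TensorProduct.rid ℤ ℂ ($hΦ (1 ⊗ₜ c F)))
  simp [Φ, hφ, hF] at h₁

/-- A rank function descends to `K₀`. -/
theorem RankFunction.exists_addMonoidHom_K0 (r : RankFunction A) :
    ∃ φ : K0 A →+ ℤ, ∀ F, φ (cl F) = r.rk F := by
  refine ⟨QuotientAddGroup.lift _ (FreeAbelianGroup.lift r.rk) ?_, fun F => ?_⟩
  · rw [kRelations, AddSubgroup.closure_le]
    rintro _ ⟨T, hT, rfl⟩
    simp [r.additive T hT]
  · exact FreeAbelianGroup.lift_apply_of r.rk F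

end RankFunction

/-! ### Finiteness and duality in Calabi–Yau categories -/

section Triangulated

variable {A : Type u} [Category.{v} A] [Preadditive A] [Linear ℂ A] [HasShift A ℤ]

/-- Morphism spaces of a Calabi-Yau category are finite dimensional. -/
theorem IsCalabiYau.finiteDimensional_hom [∀ n : ℤ, (shiftFunctor A n).Additive]
    [∀ n : ℤ, (shiftFunctor A n).Linear ℂ] {p : ℤ} (h : IsCalabiYau A p) (X Y : A) :
    FiniteDimensional ℂ (X ⟶ Y) := by
  obtain ⟨η, -, -⟩ := h
  let s : (X ⟶ Y) ≃ₗ[ℂ] (X⟦p⟧ ⟶ Y⟦p⟧) := LinearEquiv.ofBijective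
    ((shiftFunctor A p).mapLinearMap ℂ)
    ⟨(shiftFunctor A p).map_injective, (shiftFunctor A p).map_surjective⟩
  -- Duality for `(X, Y)`, then for `(Y, X⟦p⟧)`, followed by full faithfulness of the shift,
  -- identifies `Hom(X, Y)` with its bidual.
  exact .of_equiv_dual_dual (η X Y ≪≫ₗ (η Y (X⟦p⟧) ≪≫ₗ s.dualMap).symm.dualMap)

/-- Serre duality for the self-extensions of an object of a Calabi-Yau category. -/
theorem IsCalabiYau.finrank_shiftedHom_self {p : ℤ} (h : IsCalabiYau A p) (F : A) :
    Module.finrank ℂ (ShiftedHom F F p) = Module.finrank ℂ (ShiftedHom F F (0 : ℤ)) := by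
  obtain ⟨η, -, -⟩ := h
  rw [← Subspace.dual_finrank_eq, ← (η F F).finrank_eq]
  exact (Linear.homCongr ℂ (Iso.refl F) ((shiftFunctorZero A ℤ).symm.app F)).finrank_eq

/-! ### Dimensions from graded ring isomorphisms -/

section Unitary

variable {T : Type t} [Ring T] [Algebra ℂ T] {𝒯 : ℤ → Submodule ℂ T} [GradedAlgebra 𝒯]

/-- If `F` is unitary and the degree `0` part of `T` is commutative, the dimensions of the graded
pieces of `T` and of `Hom^•(F, F)` agree, although these are only isomorphic as graded rings. -/
theorem IsUnitary.finrank_eq [∀ n : ℤ, (shiftFunctor A n).Additive]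
    [∀ n : ℤ, (shiftFunctor A n).Linear ℂ]
    [IsMulCommutative (𝒯 0)] {F : A} (h : IsUnitary 𝒯 F) (k : ℤ) [FiniteDimensional ℂ (𝒯 k)]
    [FiniteDimensional ℂ (ShiftedHom F F k)] :
    Module.finrank ℂ (ShiftedHom F F k) = Module.finrank ℂ (𝒯 k) := by
  obtain ⟨φ, h₁, hm⟩ := h
  let := gradeZeroModule 𝒯 k
  let c : ℂ → ShiftedHom F F (0 : ℤ) := fun c => ShiftedHom.mk₀ 0 rfl (c • 𝟙 F)
  have hc : ∀ (x : ℂ) {l : ℤ} (f : ShiftedHom F F l), ((φ l (x • f) : 𝒯 l) : T) =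
      φ 0 (c x) * φ l f := fun x l f => by
    have h₂ : f.comp (c x) (zero_add l) = x • f := by
      simp [c, ShiftedHom.comp_mk₀]
    have h₃ := hm 0 l (c x) f
    -- Multiplicativity of `φ` lands in degree `0 + l`, which is only propositionally `l`;
    -- generalizing the degree removes the mismatch.
    have h₄ : ∀ (m : ℤ) (hm : l + 0 = m) (hm' : 0 + l = m),
        (φ m (f.comp (c x) hm') : T) = φ (0 + l) (f.comp (c x) rfl) := by
      rintro m - rfl
      rfl
    rw [← h₂, h₄ l (add_zero l) (zero_add l), h₃]
  -- The scalars of `Hom^•(F, F)` seen inside `T^0`. Nothing makes `σ` equal to `algebraMap ℂ (𝒯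
  -- 0)`, but each of the two gives the same `𝒯 0`-length of `𝒯 k`, once as the dimension of
  -- `Hom^k(F, F)` and once as that of `𝒯 k`.
  let σ : ℂ →+* 𝒯 0 :=
    { toFun := fun x => φ 0 (c x)
      map_one' := by simp only [c, one_smul]; exact h₁
      map_zero' := by simp [c]
      map_add' := fun x y => by simp [c, add_smul]
      map_mul' := fun x y => Subtype.ext (by
        change (φ 0 (c (x * y)) : T) = φ 0 (c x) * φ 0 (c y)
        rw [← hc]
        simp [c, mul_smul, ShiftedHom.mk₀]) }
  have e₁ := Module.length_eq_finrank_of_semilinear σ (φ k) fun x f => Subtype.ext (hc x f)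
  have e₂ := Module.length_eq_finrank_of_semilinear (algebraMap ℂ (𝒯 0)) (AddEquiv.refl (𝒯 k))
    fun x a => Subtype.ext (Algebra.smul_def x (a : T))
  exact_mod_cast e₁.symm.trans e₂

end Unitary

variable [HasZeroObject A] [∀ n : ℤ, (shiftFunctor A n).Additive] [Pretriangulated A]

/-! ### Algebras with unit maps inside `Hom^•(F, F)` -/

section HasUnitMaps

variable {r : RankFunction A} {T : Type t} [Ring T] [Algebra ℂ T] {𝒯 : ℤ → Submodule ℂ T}
  [GradedAlgebra 𝒯]

/-- A graded algebra with unit maps embeds into `Hom^•(F, F)` when the rank of `F` is nonzero. -/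
theorem HasUnitMaps.exists_injective (h : HasUnitMaps r 𝒯) {F : A} (hF : r.rk F ≠ 0) (k : ℤ) :
    ∃ f : 𝒯 k →ₗ[ℂ] ShiftedHom F F k, Function.Injective f := by
  obtain ⟨i, τ, -, -, -, hτ⟩ := h
  exact ⟨i F k, injective_of_leftInverse_smul hF _ (τ F k) (hτ F k)⟩

/-- The degree `0` part of a graded algebra with unit maps is commutative. -/
theorem HasUnitMaps.isMulCommutative (h : HasUnitMaps r 𝒯) {F : A} (hF : r.rk F ≠ 0) :
    IsMulCommutative (𝒯 0) := by
  obtain ⟨i, τ, -, hm, hn, hτ⟩ := h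
  have inj := fun k => injective_of_leftInverse_smul hF _ (τ F k) (hτ F k)
  refine ⟨⟨fun a b => ?_⟩⟩
  -- In degree `0`, `i_F b` is an honest endomorphism `ψ` of `F`, so naturality of `i` along `ψ`
  -- says that it commutes with `i_F a`; injectivity of `i_F` brings this back to `T^0`.
  obtain ⟨ψ, hψ⟩ := (ShiftedHom.homEquiv (0 : ℤ) rfl).surjective (i F 0 b)
  have hab := hm F 0 0 a b
  have hba := hm F 0 0 b a
  rw [← hψ, ShiftedHom.homEquiv_apply] at hab hba
  rw [ShiftedHom.comp_mk₀ (i F 0 a) 0 rfl ψ, hn] at hba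
  rw [ShiftedHom.mk₀_comp 0 rfl ψ (i F 0 a)] at hab
  have := inj _ (hab.trans hba.symm)
  exact Subtype.ext (congrArg Subtype.val this)

/-- The degree `0` part of a graded algebra with unit maps for a nonzero rank function is not
zero. -/
theorem HasUnitMaps.nontrivial (h : HasUnitMaps r 𝒯) {F : A} (hF : r.rk F ≠ 0) :
    Nontrivial (𝒯 0) := by
  obtain ⟨i, τ, h₁, -⟩ := h
  by_contra hT
  rw [not_nontrivial_iff_subsingleton] at hT
  -- If `1 = 0` in `T^0`, then `𝟙 F = i_F 1 = 0`, so `F` is a zero object and has rank zero.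
  have h₂ := h₁ F
  rw [Subsingleton.elim (⟨1, _⟩ : 𝒯 0) 0, map_zero, ← ShiftedHom.mk₀_zero F F (0 : ℤ) rfl] at h₂
  exact hF (r.rk_eq_zero_of_isZero
    ((IsZero.iff_id_eq_zero F).2 ((ShiftedHom.homEquiv (0 : ℤ) rfl).injective h₂).symm))

/-- An object of nonzero rank embeds `T^k` into a finite-dimensional `Hom` space. This is needed
because `finrank` carries no information for infinite-dimensional spaces. -/
theorem HasUnitMaps.finiteDimensional (h : HasUnitMaps r 𝒯) (hr : r.IsNontrivial)
    (hA : ∀ X Y : A, FiniteDimensional ℂ (X ⟶ Y)) (k : ℤ) : FiniteDimensional ℂ (𝒯 k) := by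
  obtain ⟨F, hF⟩ := hr
  obtain ⟨f, hf⟩ := h.exists_injective hF k
  have := hA F (F⟦k⟧)
  exact Module.Finite.of_injective f hf

end HasUnitMaps

end Triangulated

/-! ### Hodge numbers and the algebra `ℂ ⊕ ℂ[3]` -/

/-- The Hodge numbers only depend on the dimensions of the graded pieces of degrees `0`, …, `3`. -/
theorem hodgeNumber_congr (C : DGAlgebra.{w}) {T₁ : Type t₁} [Ring T₁] [Algebra ℂ T₁]
    {𝒯₁ : ℤ → Submodule ℂ T₁} {T₂ : Type t₂} [Ring T₂] [Algebra ℂ T₂] {𝒯₂ : ℤ → Submodule ℂ T₂}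
    (h : ∀ k ∈ Set.Icc (0 : ℤ) 3,
      Module.finrank ℂ (𝒯₁ k) = Module.finrank ℂ (𝒯₂ k)) (p q : Fin 4) :
    hodgeNumber C 𝒯₁ p q = hodgeNumber C 𝒯₂ p q := by
  have h₀ := h 0 (by simp)
  have h₁ := h 1 (by simp)
  have h₂ := h 2 (by simp)
  have h₃ := h 3 (by simp)
  fin_cases p <;> fin_cases q <;> simp [hodgeNumber, h₀, h₁, h₂, h₃]

/-- The dimensions of the graded pieces of `ℂ ⊕ ℂ[3]`. -/
theorem IsSphereAlgebra.finrank_eq {T : Type t} [Ring T] [Algebra ℂ T] {𝒯 : ℤ → Submodule ℂ T}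
    (h : IsSphereAlgebra 𝒯) (k : ℤ) :
    Module.finrank ℂ (𝒯 k) = if k = 0 ∨ k = 3 then 1 else 0 := by
  obtain ⟨φ, hφ⟩ := h
  have h₁ : Module.finrank ℂ (sphereGrading k) = Module.finrank ℂ (𝒯 k) := by
    rw [← hφ k]
    exact (Submodule.equivMapOfInjective φ.toLinearMap φ.injective (𝒯 k)).finrank_eq.symm
  rw [← h₁]
  rcases eq_or_ne k 0 with rfl | h0
  · rw [if_pos (Or.inl rfl), sphereGrading, if_pos rfl]
    exact (LinearMap.finrank_range_of_inj (f := (TrivSqZeroExt.inlAlgHom ℂ ℂ ℂ).toLinearMap)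
      TrivSqZeroExt.inl_injective).trans (Module.finrank_self ℂ)
  rcases eq_or_ne k 3 with rfl | h3
  · rw [if_pos (Or.inr rfl), sphereGrading, if_neg h0, if_pos rfl]
    exact (LinearMap.finrank_range_of_inj (f := TrivSqZeroExt.inrHom ℂ ℂ)
      TrivSqZeroExt.inr_injective).trans (Module.finrank_self ℂ)
  · rw [if_neg (by tauto), sphereGrading, if_neg h0, if_neg h3, finrank_bot]

/-! ### Comparison of two homological units -/

section Comparison

variable {A : Type u} [Category.{v} A] [Preadditive A] [Linear ℂ A] [HasZeroObject A]
  [HasShift A ℤ] [∀ n : ℤ, (shiftFunctor A n).Additive] [∀ n : ℤ, (shiftFunctor A n).Linear ℂ]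
  [Pretriangulated A] {r₁ r₂ : RankFunction A}
  {T₁ : Type t₁} [Ring T₁] [Algebra ℂ T₁] {𝒯₁ : ℤ → Submodule ℂ T₁} [GradedAlgebra 𝒯₁]
  {T₂ : Type t₂} [Ring T₂] [Algebra ℂ T₂] {𝒯₂ : ℤ → Submodule ℂ T₂} [GradedAlgebra 𝒯₂]

/-- If an object is unitary for `T₁` and has nonzero rank for `r₂`, then `T₂` is at most as large
as `T₁`. -/
theorem HasUnitMaps.finrank_le (hA : ∀ X Y : A, FiniteDimensional ℂ (X ⟶ Y))
    (h₁ : HasUnitMaps r₁ 𝒯₁) (hr₁ : r₁.IsNontrivial) (h₂ : HasUnitMaps r₂ 𝒯₂)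
    {F : A} (hF : IsUnitary 𝒯₁ F) (hF₂ : r₂.rk F ≠ 0) (k : ℤ) :
    Module.finrank ℂ (𝒯₂ k) ≤ Module.finrank ℂ (𝒯₁ k) := by
  obtain ⟨f, hf⟩ := h₂.exists_injective hF₂ k
  -- The first rank of `F` may vanish, so commutativity and finiteness of `T₁` are taken from
  -- another object `G`.
  obtain ⟨G, hG⟩ := hr₁
  have := h₁.isMulCommutative hG
  have := h₁.finiteDimensional ⟨G, hG⟩ hA k
  have := hA F (F⟦k⟧)
  rw [← hF.finrank_eq k]
  exact LinearMap.finrank_le_finrank_of_injective hf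

/-- If each of two graded algebras with unit maps has a unitary object which has nonzero rank for
the other rank function, then their Hodge numbers agree. -/
theorem hodgeNumber_eq_of_isUnitary (C : DGAlgebra.{w}) (hCY : IsCalabiYau A 3)
    (h₁ : HasUnitMaps r₁ 𝒯₁) (hr₁ : r₁.IsNontrivial) (h₂ : HasUnitMaps r₂ 𝒯₂)
    (hr₂ : r₂.IsNontrivial) (hF : ∃ F ∈ {F : A | IsUnitary 𝒯₁ F}, r₂.rk F ≠ 0)
    (hG : ∃ G ∈ {G : A | IsUnitary 𝒯₂ G}, r₁.rk G ≠ 0) (p q : Fin 4) :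
    hodgeNumber C 𝒯₁ p q = hodgeNumber C 𝒯₂ p q := by
  obtain ⟨F, hF, hF₂⟩ := hF
  obtain ⟨G, hG, hG₁⟩ := hG
  exact hodgeNumber_congr C (fun k _ => le_antisymm
    (h₂.finrank_le hCY.finiteDimensional_hom hr₂ h₁ hG hG₁ k)
    (h₁.finrank_le hCY.finiteDimensional_hom hr₁ h₂ hF hF₂ k)) p q

/-- If `T₁` is `ℂ ⊕ ℂ[3]`, it is enough that one of its unitary objects has nonzero rank for `r₂`,
and that there is a unitary object for `T₂`, of which Serre duality gives a class of degree `3`. -/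
theorem hodgeNumber_eq_of_isSphereAlgebra (C : DGAlgebra.{w}) (hCY : IsCalabiYau A 3)
    (hT₁ : IsSphereAlgebra 𝒯₁) (h₁ : HasUnitMaps r₁ 𝒯₁) (hr₁ : r₁.IsNontrivial)
    (h₂ : HasUnitMaps r₂ 𝒯₂) (hr₂ : r₂.IsNontrivial)
    (hF : ∃ F ∈ {F : A | IsUnitary 𝒯₁ F}, r₂.rk F ≠ 0) (hG : ∃ G : A, IsUnitary 𝒯₂ G)
    (p q : Fin 4) : hodgeNumber C 𝒯₁ p q = hodgeNumber C 𝒯₂ p q := by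
  obtain ⟨F, hF, hF₂⟩ := hF
  obtain ⟨G, hG⟩ := hG
  obtain ⟨E, hE⟩ := hr₂
  have hA := hCY.finiteDimensional_hom
  have := h₂.isMulCommutative hE
  have := h₂.nontrivial hE
  have := h₂.finiteDimensional ⟨E, hE⟩ hA
  have := fun k : ℤ => hA G (G⟦k⟧)
  have hle := h₁.finrank_le hA hr₁ h₂ hF hF₂
  simp only [hT₁.finrank_eq] at hle
  have h₀ : Module.finrank ℂ (𝒯₂ 0) = 1 := le_antisymm (by simpa using hle 0) Module.finrank_pos
  have h₃ : Module.finrank ℂ (𝒯₂ 3) = 1 := by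
    -- No rank of `G` enters: unitarity is used in degrees `3` and `0`, with Serre duality between
    -- them.
    rw [← hG.finrank_eq, hCY.finrank_shiftedHom_self, hG.finrank_eq, h₀]
  refine hodgeNumber_congr C (fun k _ => ?_) p q
  rw [hT₁.finrank_eq]
  split_ifs with hk
  · rcases hk with rfl | rfl
    exacts [h₀.symm, h₃.symm]
  · have := hle k
    rw [if_neg hk] at this
    omega

end Comparison

end CYHodge

/-! ### The main theorem -/

open CYHodge in
theorem theorem3p2
    {A : Type u} [Category.{v} A] [Preadditive A] [Linear ℂ A] [HasZeroObject A]
    [HasShift A ℤ] [∀ n : ℤ, (shiftFunctor A n).Additive] [∀ n : ℤ, (shiftFunctor A n).Linear ℂ]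
    [Pretriangulated A] [IsTriangulated A]
    (R : SmoothProperRealization.{w} A) (hCY : IsCalabiYau A 3)
    (r₁ r₂ : RankFunction A) (hr₁ : r₁.IsNontrivial) (hr₂ : r₂.IsNontrivial)
    {T₁ : Type t₁} [Ring T₁] [Algebra ℂ T₁] (𝒯₁ : ℤ → Submodule ℂ T₁) [GradedAlgebra 𝒯₁]
    {T₂ : Type t₂} [Ring T₂] [Algebra ℂ T₂] (𝒯₂ : ℤ → Submodule ℂ T₂) [GradedAlgebra 𝒯₂]
    (hT₁ : IsHomologicalUnit r₁ 𝒯₁) (hT₂ : IsHomologicalUnit r₂ 𝒯₂) :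
    ((GeneratesK0 {F : A | IsUnitary 𝒯₁ F} → GeneratesK0 {F : A | IsUnitary 𝒯₂ F} →
        ∀ p q, hodgeNumber R.C 𝒯₁ p q = hodgeNumber R.C 𝒯₂ p q) ∧
      (IsSphereAlgebra 𝒯₁ → GeneratesK0 {F : A | IsUnitary 𝒯₁ F} →
        (∃ F : A, IsUnitary 𝒯₂ F) →
        ∀ p q, hodgeNumber R.C 𝒯₁ p q = hodgeNumber R.C 𝒯₂ p q)) ∧
    (r₁.IsNumerical → r₂.IsNumerical →
      (GeneratesKNum {F : A | IsUnitary 𝒯₁ F} → GeneratesKNum {F : A | IsUnitary 𝒯₂ F} →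
        ∀ p q, hodgeNumber R.C 𝒯₁ p q = hodgeNumber R.C 𝒯₂ p q) ∧
      (IsSphereAlgebra 𝒯₁ → GeneratesKNum {F : A | IsUnitary 𝒯₁ F} →
        (∃ F : A, IsUnitary 𝒯₂ F) →
        ∀ p q, hodgeNumber R.C 𝒯₁ p q = hodgeNumber R.C 𝒯₂ p q)) := by
  -- Descent to `K₀` is automatic from additivity, whereas descent to `K_num` is the numerical
  -- hypothesis, which supplies `ψ₁` and `ψ₂` below.
  obtain ⟨φ₁, hφ₁⟩ := r₁.exists_addMonoidHom_K0
  obtain ⟨φ₂, hφ₂⟩ := r₂.exists_addMonoidHom_K0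
  refine ⟨⟨fun g₁ g₂ => ?_, fun hS g₁ hG => ?_⟩,
    fun ⟨ψ₁, hψ₁⟩ ⟨ψ₂, hψ₂⟩ => ⟨fun g₁ g₂ => ?_, fun hS g₁ hG => ?_⟩⟩
  · exact hodgeNumber_eq_of_isUnitary R.C hCY hT₁.1 hr₁ hT₂.1 hr₂
      (RankFunction.exists_mem_rk_ne_zero hr₂ cl φ₂ hφ₂ g₁)
      (RankFunction.exists_mem_rk_ne_zero hr₁ cl φ₁ hφ₁ g₂)
  · exact hodgeNumber_eq_of_isSphereAlgebra R.C hCY hS hT₁.1 hr₁ hT₂.1 hr₂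
      (RankFunction.exists_mem_rk_ne_zero hr₂ cl φ₂ hφ₂ g₁) hG
  · exact hodgeNumber_eq_of_isUnitary R.C hCY hT₁.1 hr₁ hT₂.1 hr₂
      (RankFunction.exists_mem_rk_ne_zero hr₂ clNum ψ₂ hψ₂ g₁)
      (RankFunction.exists_mem_rk_ne_zero hr₁ clNum ψ₁ hψ₁ g₂)
  · exact hodgeNumber_eq_of_isSphereAlgebra R.C hCY hS hT₁.1 hr₁ hT₂.1 hr₂
      (RankFunction.exists_mem_rk_ne_zero hr₂ clNum ψ₂ hψ₂ g₁) hG
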